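/- All tensors are over $\mathbb{C}$ and $\log=\log_2$. The rank $\mathrm{R}(T)$ of $T\in V_1\otimes\cdots\otimes V_k$ is the least $r$ such that $T$ is a sum of $r$ tensors of the form $v_1\otimes\cdots\otimes v_k$. The Kronecker product of $T \in V_1\otimes\cdots\otimes V_k$ and $S\in W_1\otimes\cdots\otimes W_k$ is $T\otimes S$ regarded as a tensor $T\boxtimes S\in (V_1\otimes W_1)\otimes\cdots\otimes(V_k\otimes W_k)$. The exponent of $T$ is $\omega(T)=\log\lim_{N\to\infty}\mathrm{R}(T^{\boxtimes N})^{1/N}$. For positive integers $a,b$ let $\mathbf{Dome}(a;b)$ be the tensor of order four $$\mathbf{Dome}(a;b)=\sum_{i_1,i_2,i_3=1}^{a}\ \sum_{\ell=1}^{b} e_{i_1,\ell}\otimes e_{i_2,\ell}\otimes e_{i_3,\ell}\otimes e_{i_1,i_2,i_3}\ \in\ (\mathbb{C}^{a}\otimes\mathbb{C}^{b})^{\otimes 3}\otimes(\mathbb{C}^{a})^{\otimes 3},$$ that is, the graph tensor on the vertices $1,2,3,4$ with edges $\{1,4\},\{2,4\},\{3,4\}$ of weight $a$ and hyperedge $\{1,2,3\}$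 of weight $b$; it satisfies $\mathbf{Dome}(a;b)^{\boxtimes N}=\mathbf{Dome}(a^N;b^N)$ up to relabelling bases. Let $h(p)=-p\log p-(1-p)\log(1-p)$. **Theorem.** Let $n\ge 2$ be even, let $M=\tfrac14 n^3$ and let $p\in(0,1)$. Then $$\omega\bigl(\mathbf{Dome}((n+1)^{p};M^{1-p})\bigr)\ \le\ \log\bigl((n+1)^3+1\bigr)-h(p).$$ Since the weights $(n+1)^p$ and $M^{1-p}$ need not be integers, this means the following. 1. For every $N\in\mathbb{N}$ for which $a=(n+1)^{pN}$ and $b=M^{(1-p)N}$ are integers (in particular whenever $pN$ is an integer), $$\omega\bigl(\mathbf{Dome}(a;b)\bigr)\ \le\ N\bigl(\log((n+1)^3+1)-h(p)\bigr).$$ 2. For every $p\in(0,1)$, rational or not, and every $\varepsilon>0$, for all sufficiently large $N$, $$\mathrm{R}\Bigl(\mathbf{Dome}\bigl(\lceil (n+1)^{pN}\rceil;\lceil M^{(1-p)N}\rceil\bigr)\Bigr)\ \le\ 2^{N\left(\log((n+1)^3+1)-h(p)+\varepsilon\right)}.$$ -/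

import Mathlib

/-- A tensor in the tensor product over `v : V` of the coordinate spaces `ℂ^(ι v)`, given by its
array of coordinates with respect to the standard bases. -/
abbrev CTensor {V : Type} (ι : V → Type) : Type := (∀ v, ι v) → ℂ

/-- Tensor rank: the least `r` such that `T` is a sum of `r` products
`w j v₁ ⊗ ⋯ ⊗ w j vₖ` of vectors. -/
noncomputable def tensorRank {V : Type} [Fintype V] {ι : V → Type} (T : CTensor ι) : ℕ :=
  sInf {r : ℕ | ∃ w : Fin r → ∀ v, ι v → ℂ, ∀ x, T x = ∑ j, ∏ v, w j v (x v)}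

/-- Kronecker product of a finite family of tensors with the same set `V` of factors: the factors
belonging to the same `v` are grouped together, so that the basis of the new factor at `v` is
indexed by tuples `e ↦ (index of T e at v)`. -/
def kronecker {V E : Type} [Fintype E] {ι : E → V → Type} (T : ∀ e, CTensor (ι e)) :
    CTensor (fun v => ∀ e, ι e v) :=
  fun x => ∏ e, T e (fun v => x v e)

/-- The Kronecker power `T ⊠ ⋯ ⊠ T` with `N` factors. -/
def kroneckerPow {V : Type} {ι : V → Type} (T : CTensor ι) (N : ℕ) :
    CTensor (fun v => Fin N → ι v) :=
  kronecker (fun _ : Fin N => T)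

/-- Asymptotic rank: the limit of `R(T^{⊠N})^{1/N}`. The sequence is bounded and converges
(submultiplicativity of rank and Fekete's lemma), so that its upper limit is its limit. -/
noncomputable def asymptoticRank {V : Type} [Fintype V] {ι : V → Type} (T : CTensor ι) : ℝ :=
  Filter.limsup (fun N : ℕ => (tensorRank (kroneckerPow T N) : ℝ) ^ ((N : ℝ)⁻¹)) Filter.atTop

/-- The exponent `ω(T)`: the base-2 logarithm of the asymptotic rank. -/
noncomputable def tensorExponent {V : Type} [Fintype V] {ι : V → Type} (T : CTensor ι) : ℝ :=
  Real.logb 2 (asymptoticRank T)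

/-- The unit tensor of size `m` on the vertices in `I`, extended by a basis vector of a
one-dimensional space at every other vertex. The basis at `v` is indexed by `v ∈ I → Fin m`, which
is a copy of `Fin m` if `v ∈ I` and has exactly one element otherwise; the `j`-th summand is the
tensor product of the basis vectors with index `fun _ => j`. -/
def edgeTensor {V : Type} [Fintype V] [DecidableEq V] (I : Finset V) (m : ℕ) :
    CTensor (fun v : V => v ∈ I → Fin m) :=
  fun x => ∑ j : Fin m, ∏ v, if ∀ h : v ∈ I, x v h = j then 1 else 0

/-- The graph tensor of a hypergraph with vertex set `V`, hyperedges `edge e` and weights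
`weight e`: the Kronecker product of the unit tensors of its hyperedges. -/
def graphTensor {V E : Type} [Fintype V] [DecidableEq V] [Fintype E]
    (edge : E → Finset V) (weight : E → ℕ) :
    CTensor (fun v : V => ∀ e, v ∈ edge e → Fin (weight e)) :=
  kronecker (fun e => edgeTensor (edge e) (weight e))

/-- The hypergraph of the dome tensor: the central vertex `3` is joined by an edge to each of the
vertices `0, 1, 2`, and there is one hyperedge `{0, 1, 2}`. -/
def domeEdge : Fin 4 → Finset (Fin 4) := ![{0, 3}, {1, 3}, {2, 3}, {0, 1, 2}]

/-- The dome tensor `Dome(n₁, n₂, n₃; M)`: weight `nᵢ` on the `i`-th edge at the central vertex and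
weight `M` on the hyperedge of order three. -/
def domeTensor (n₁ n₂ n₃ M : ℕ) :
    CTensor (fun v : Fin 4 => ∀ e : Fin 4, v ∈ domeEdge e → Fin ((![n₁, n₂, n₃, M] : Fin 4 → ℕ) e)) :=
  graphTensor domeEdge ![n₁, n₂, n₃, M]

/-- The binary entropy function, with logarithms in base 2. -/
noncomputable def binaryEntropy (p : ℝ) : ℝ :=
  -p * Real.logb 2 p - (1 - p) * Real.logb 2 (1 - p)

/-! Write `R = (n+1)^3 + 1`. As in Schönhage's example for matrix multiplication, `Dome(n+1; 1)`
takes `(n+1)^3` products, and a degeneration yields `Dome(1; M)` in direct sum with it for a single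
extra one. Sum `(e_i + X u)(e_j + X v)(e_k + X w)(X^3 e_ijk + f)` over the grid points `(i,j,k)`,
with `u, v, w` depending on the point, and subtract `(∑ e_i)(∑ e_j)(∑ e_k) f`. The lowest term is
the direct sum, in degree 3, if the line sums of `u, v, w` and the plane sums of products of two of
them vanish and the total of `u v w` is a unit tensor (`domeSum_degeneration`). Signs on the parity
classes of `2 × 2 × 2` cubes achieve this for `M = n^3/4`; one extra layer per direction repairs the
line sums and turns `n` into `n+1` (`rankLE_kroneckerPow_domeSum`).

The power `k + l` of the direct sum, with `k ≈ pN` and `l ≈ (1-p)N`, contains `(k+l).choose k ≈ 2^(N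
h(p))` disjoint copies of `Dome((n+1)^k; M^l)` (`restricts_copies_domeOn`). By the asymptotic sum
inequality (`RankLE.kroneckerPow_of_copies`) one copy asymptotically costs `R^(k+l)` divided by the
number of copies, which is where `-h(p)` comes from. -/

open Polynomial

/-! ### Rank bounds and pullbacks. -/

/-- `T` is a sum of at most `r` products of vectors. -/
def RankLE {V : Type} [Fintype V] {ι : V → Type} (T : CTensor ι) (r : ℕ) : Prop :=
  ∃ m ≤ r, ∃ w : Fin m → ∀ v, ι v → ℂ, ∀ x, T x = ∑ j, ∏ v, w j v (x v)

/-- `S` is the pullback of `T` along maps between the index sets of the bases. -/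
def Restricts {V : Type} {ι κ : V → Type} (S : CTensor ι) (T : CTensor κ) : Prop :=
  ∃ φ : ∀ v, ι v → κ v, ∀ x, S x = T (fun v => φ v (x v))

theorem Restricts.trans {V : Type} {ι κ μ : V → Type} {S : CTensor ι} {T : CTensor κ}
    {U : CTensor μ} (h : Restricts S T) (h' : Restricts T U) : Restricts S U := by
  obtain ⟨φ, hφ⟩ := h
  obtain ⟨ψ, hψ⟩ := h'
  exact ⟨fun v y => ψ v (φ v y), fun x => by rw [hφ, hψ]⟩

theorem Restricts.kroneckerPow {V : Type} {ι κ : V → Type} {S : CTensor ι} {T : CTensor κ}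
    (h : Restricts S T) (N : ℕ) : Restricts (kroneckerPow S N) (kroneckerPow T N) := by
  obtain ⟨φ, hφ⟩ := h
  exact ⟨fun v y t => φ v (y t), fun x => by simp only [_root_.kroneckerPow, kronecker, hφ]⟩

/-! ### Degenerations and the asymptotic sum inequality. -/

section Rank

variable {V : Type} [Fintype V] {ι κ μ : V → Type}

theorem RankLE.of_fintype {T : CTensor ι} {J : Type} [Fintype J] (w : J → ∀ v, ι v → ℂ)
    (h : ∀ x, T x = ∑ j, ∏ v, w j v (x v)) {r : ℕ} (hr : Fintype.card J ≤ r) : RankLE T r := by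
  refine ⟨_, hr, fun j => w ((Fintype.equivFin J).symm j), fun x => ?_⟩
  rw [h]
  exact (Equiv.sum_comp (Fintype.equivFin J).symm (fun j => ∏ v, w j v (x v))).symm

theorem RankLE.mono {T : CTensor ι} {r s : ℕ} (h : RankLE T r) (hrs : r ≤ s) : RankLE T s := by
  obtain ⟨m, hm, w, hw⟩ := h
  exact ⟨m, hm.trans hrs, w, hw⟩

theorem RankLE.tensorRank_le {T : CTensor ι} {r : ℕ} (h : RankLE T r) : tensorRank T ≤ r := by
  obtain ⟨m, hm, w, hw⟩ := h
  refine le_trans (Nat.sInf_le ?_) hm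
  exact ⟨w, hw⟩

theorem RankLE.restrict {S : CTensor ι} {T : CTensor κ} {r : ℕ} (h : RankLE T r)
    (hST : Restricts S T) : RankLE S r := by
  obtain ⟨m, hm, w, hw⟩ := h
  obtain ⟨φ, hφ⟩ := hST
  exact ⟨m, hm, fun j v y => w j v (φ v y), fun x => by rw [hφ, hw]⟩

/-- A rank decomposition can be padded with zeros to be indexed by any type that is large
enough. -/
theorem RankLE.exists_decomposition [Nonempty V] {T : CTensor ι} {J : Type} [Fintype J]
    (h : RankLE T (Fintype.card J)) :
    ∃ w : J → ∀ v, ι v → ℂ, ∀ x, T x = ∑ j, ∏ v, w j v (x v) := by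
  classical
  obtain ⟨m, hm, w, hw⟩ := h
  obtain ⟨e⟩ : Nonempty (Fin m ↪ J) := Function.Embedding.nonempty_of_card_le (by simpa using hm)
  refine ⟨fun j v y => ∑ i, if e i = j then w i v y else 0, fun x => ?_⟩
  rw [hw]
  have himage (i : Fin m) : ∏ v, (∑ i', if e i' = e i then w i' v (x v) else 0) =
      ∏ v, w i v (x v) := by
    simp [e.injective.eq_iff]
  have hzero (j : J) (hj : j ∉ Finset.univ.map e) :
      ∏ v, (∑ i', if e i' = j then w i' v (x v) else 0) = 0 := by
    refine Finset.prod_eq_zero (Finset.mem_univ (Classical.arbitrary V)) ?_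
    refine Finset.sum_eq_zero fun i _ => if_neg fun h => hj ?_
    simp [← h]
  rw [← Finset.sum_subset (Finset.subset_univ (Finset.univ.map e)) fun j _ => hzero j,
    Finset.sum_map]
  exact Finset.sum_congr rfl fun i _ => (himage i).symm

theorem card_finsuppAntidiag_univ_le [DecidableEq V] (D : ℕ) :
    (Finset.finsuppAntidiag (Finset.univ : Finset V) D).card ≤ (D + 1) ^ Fintype.card V := by
  have : (D + 1) ^ Fintype.card V = (Finset.univ : Finset (V → Fin (D + 1))).card := by simp
  rw [this]
  have hle (l : V →₀ ℕ) (hl : l ∈ Finset.finsuppAntidiag Finset.univ D) (v : V) : l v < D + 1 := by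
    rw [Finset.mem_finsuppAntidiag] at hl
    rw [← hl.1]
    exact Nat.lt_succ_of_le (Finset.single_le_sum (f := l) (fun _ _ => Nat.zero_le _)
      (Finset.mem_univ v))
  refine Finset.card_le_card_of_injOn (fun l v => Fin.ofNat (D + 1) (l v)) (by simp) ?_
  intro l hl l' hl' h
  ext v
  have := congrArg Fin.val (congrFun h v)
  simpa [Fin.ofNat, Nat.mod_eq_of_lt (hle l hl v), Nat.mod_eq_of_lt (hle l' hl' v)] using this

theorem coeff_prod_univ [DecidableEq V] (P : V → ℂ[X]) (D : ℕ) :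
    (∏ v, P v).coeff D =
      ∑ l ∈ Finset.finsuppAntidiag Finset.univ D, ∏ v, (P v).coeff (l v) := by
  have := PowerSeries.coeff_prod (fun v => (P v : PowerSeries ℂ)) D Finset.univ
  simp only [Polynomial.coeff_coe] at this
  rw [← this, ← Polynomial.coeff_coe]
  congr 1
  exact map_prod Polynomial.coeToPowerSeries.ringHom P Finset.univ

/-- A degeneration of order `d` with `card J` products bounds the rank of all Kronecker powers. -/
theorem RankLE.kroneckerPow_of_degeneration {T : CTensor ι} {J : Type} [Fintype J]
    (w : J → ∀ v, ι v → ℂ[X]) (d : ℕ)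
    (h : ∀ x, ∃ q : ℂ[X], ∑ j, ∏ v, w j v (x v) = X ^ d * (C (T x) + X * q)) (N : ℕ) :
    RankLE (kroneckerPow T N)
      (Fintype.card J ^ N * (d * N + 1) ^ Fintype.card V) := by
  classical
  choose q hq using h
  -- One product for each choice of a summand in every factor and each way to split the degree `d *
  -- N` among the vertices. The coefficient of `X ^ (d * N)` sees only the leading terms.
  refine RankLE.of_fintype
    (J := (Fin N → J) × Finset.finsuppAntidiag (Finset.univ : Finset V) (d * N))
    (fun j v y => (∏ t, w (j.1 t) v (y t)).coeff (j.2.1 v)) (fun x => ?_) ?_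
  · have hpow : ∏ t : Fin N, ∑ j, ∏ v, w j v (x v t) = X ^ (d * N) *
        ∏ t : Fin N, (C (T fun v => x v t) + X * q fun v => x v t) := by
      rw [Finset.prod_congr rfl fun t _ => hq fun v => x v t, Finset.prod_mul_distrib]
      simp [pow_mul]
    have hcoeff : (∏ t : Fin N, ∑ j, ∏ v, w j v (x v t)).coeff (d * N) =
        ∏ t, T (fun v => x v t) := by
      rw [hpow]
      have := Polynomial.coeff_X_pow_mul
        (∏ t : Fin N, (C (T fun v => x v t) + X * q fun v => x v t)) (d * N) 0
      rw [zero_add] at this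
      rw [this, Polynomial.coeff_zero_eq_eval_zero, Polynomial.eval_prod]
      simp
    have hexpand : ∏ t : Fin N, ∑ j, ∏ v, w j v (x v t) =
        ∑ J : Fin N → J, ∏ v, ∏ t, w (J t) v (x v t) := by
      rw [Finset.prod_univ_sum, Fintype.piFinset_univ]
      exact Finset.sum_congr rfl fun J _ => Finset.prod_comm
    rw [Fintype.sum_prod_type]
    change ∏ t, T (fun v => x v t) = _
    rw [← hcoeff, hexpand, Polynomial.finsetSum_coeff]
    refine Finset.sum_congr rfl fun J _ => ?_
    rw [coeff_prod_univ]
    exact (Finset.sum_coe_sort _ fun l : V →₀ ℕ =>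
      ∏ v, (∏ t, w (J t) v (x v t)).coeff (l v)).symm
  · rw [Fintype.card_prod, Fintype.card_fun, Fintype.card_fin, Fintype.card_coe]
    exact Nat.mul_le_mul_left _ (card_finsuppAntidiag_univ_le _)

/-- The direct sum of copies of `T` indexed by `Γ`. -/
def copies (Γ : Type) [Fintype Γ] [DecidableEq Γ] (T : CTensor ι) : CTensor (fun v => Γ × ι v) :=
  fun x => ∑ γ, (∏ v, if (x v).1 = γ then 1 else 0) * T (fun v => (x v).2)

theorem restricts_copies [Nonempty V] {Γ : Type} [Fintype Γ] [DecidableEq Γ] (γ : Γ)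
    (T : CTensor ι) : Restricts T (copies Γ T) := by
  refine ⟨fun v y => (γ, y), fun x => ?_⟩
  simp only [copies]
  rw [Finset.sum_eq_single γ]
  · simp
  · intro γ' _ h
    simp [h.symm]
  · simp

/-- If `c * card Γ` products suffice for `card Γ` copies of `T`, then multiplying `S` by `T` increases
the rank of `card Γ` copies of `S` by a factor of at most `c`. -/
theorem RankLE.copies_mul [Nonempty V] {Γ : Type} [Fintype Γ] [DecidableEq Γ]
    {T : CTensor ι} {S : CTensor κ} {U : CTensor μ} {c r : ℕ}
    (hT : RankLE (copies Γ T) (c * Fintype.card Γ)) (hS : RankLE (copies Γ S) r)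
    (a : ∀ v, μ v → ι v) (b : ∀ v, μ v → κ v)
    (hU : ∀ x, U x = T (fun v => a v (x v)) * S (fun v => b v (x v))) :
    RankLE (copies Γ U) (c * r) := by
  classical
  -- The products for `T` are arranged in `c` blocks of `card Γ`. Tensoring one block with `S` gives
  -- a linear image of `card Γ` copies of `S`, so `r` products suffice per block.
  obtain ⟨g, hg⟩ := RankLE.exists_decomposition (J := Fin c × Γ) (by simpa using hT)
  obtain ⟨F, hF⟩ := RankLE.exists_decomposition (J := Fin r) (by simpa using hS)
  refine RankLE.of_fintype (J := Fin c × Fin r)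
    (fun j v y => ∑ γ, g (j.1, γ) v (y.1, a v y.2) * F j.2 v (γ, b v y.2)) (fun x => ?_) (by simp)
  have hcopies : copies Γ U x =
      copies Γ T (fun v => ((x v).1, a v (x v).2)) * S (fun v => b v (x v).2) := by
    simp only [copies, hU, Finset.sum_mul, mul_assoc]
  rw [hcopies, hg, Fintype.sum_prod_type, Fintype.sum_prod_type, Finset.sum_mul]
  refine Finset.sum_congr rfl fun i _ => ?_
  simp only [Finset.prod_univ_sum, Fintype.piFinset_univ, Finset.prod_mul_distrib]
  rw [Finset.sum_comm]
  -- Summing over `l` reassembles the copies of `S`, which vanish unless `γ` is constant; this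
  -- removes the cross terms of the expanded product.
  have hinner (γ : V → Γ) : ∑ l, (∏ v, g (i, γ v) v ((x v).1, a v (x v).2)) *
      ∏ v, F l v (γ v, b v (x v).2) = ∑ γ₀, (∏ v, if γ v = γ₀ then
        g (i, γ v) v ((x v).1, a v (x v).2) else 0) * S (fun v => b v (x v).2) := by
    rw [← Finset.mul_sum, ← hF fun v => (γ v, b v (x v).2)]
    simp only [copies, Finset.mul_sum, ← mul_assoc, ← Finset.prod_mul_distrib, mul_ite, mul_one,
      mul_zero]
  rw [Finset.sum_congr rfl fun γ _ => hinner γ, Finset.sum_comm, Finset.sum_mul]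
  refine Finset.sum_congr rfl fun γ₀ _ => ?_
  rw [← Finset.sum_mul]
  congr 1
  have := Finset.prod_univ_sum (fun _ : V => (Finset.univ : Finset Γ))
    (fun v γ => if γ = γ₀ then g (i, γ) v ((x v).1, a v (x v).2) else 0)
  rw [Fintype.piFinset_univ] at this
  rw [← this]
  simp

/-- All copies are kept through the induction, so that `card Γ` is paid only once, for the power
zero, and each further factor costs `c`. -/
theorem RankLE.copies_kroneckerPow [Nonempty V] {Γ : Type} [Fintype Γ] [DecidableEq Γ]
    {T : CTensor ι} {c : ℕ} (hT : RankLE (copies Γ T) (c * Fintype.card Γ)) (s : ℕ) :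
    RankLE (copies Γ (kroneckerPow T s)) (c ^ s * Fintype.card Γ) := by
  induction s with
  | zero =>
    refine RankLE.of_fintype (J := Γ) (fun γ v y => if y.1 = γ then 1 else 0) (fun x => ?_)
      (by simp)
    simp [copies, kroneckerPow, kronecker]
  | succ s ih =>
    rw [pow_succ', mul_assoc]
    exact hT.copies_mul ih (fun v y => y 0) (fun v y => Fin.tail y) fun x => Fin.prod_univ_succ _

/-- Schönhage's asymptotic sum inequality for equal summands. -/
theorem RankLE.kroneckerPow_of_copies [Nonempty V] {Γ : Type} [Fintype Γ] [DecidableEq Γ]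
    [Nonempty Γ] {T : CTensor ι} {c : ℕ} (hT : RankLE (copies Γ T) (c * Fintype.card Γ)) (s : ℕ) :
    RankLE (kroneckerPow T s) (c ^ s * Fintype.card Γ) :=
  (hT.copies_kroneckerPow s).restrict (restricts_copies (Classical.arbitrary Γ) _)

end Rank

/-! ### Dome tensors and their direct sum over arbitrary index types. -/

/-- The dome tensor with arbitrary index types. At every vertex the basis is indexed by a label for
each of the three edges and a label for the hyperedge, of which only those of the incident edges are
read. -/
def domeOn (α β : Type) [DecidableEq α] [DecidableEq β] :
    CTensor (fun _ : Fin 4 => (Fin 3 → α) × β) :=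
  fun x => if (∀ i : Fin 3, (x i.castSucc).1 i = (x 3).1 i) ∧ (x 0).2 = (x 1).2 ∧
    (x 1).2 = (x 2).2 then 1 else 0

/-- The support of the direct sum of `Dome(α; 1)` and `Dome(1; β)`. -/
def DomeSumSupport {α β : Type} (x : Fin 4 → (Fin 3 → α) ⊕ β) : Prop :=
  (∃ y : Fin 4 → Fin 3 → α, (∀ v, x v = Sum.inl (y v)) ∧ ∀ i : Fin 3, y i.castSucc i = y 3 i) ∨
    ∃ z : Fin 4 → β, (∀ v, x v = Sum.inr (z v)) ∧ z 0 = z 1 ∧ z 1 = z 2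

open Classical in
/-- The direct sum of `Dome(α; 1)` and `Dome(1; β)`. -/
noncomputable def domeSum (α β : Type) : CTensor (fun _ : Fin 4 => (Fin 3 → α) ⊕ β) :=
  fun x => if DomeSumSupport x then 1 else 0

theorem domeSum_inl {α β : Type} [DecidableEq α] {x : Fin 4 → (Fin 3 → α) ⊕ β}
    {a b c d : Fin 3 → α} (h0 : x 0 = .inl a) (h1 : x 1 = .inl b) (h2 : x 2 = .inl c)
    (h3 : x 3 = .inl d) :
    domeSum α β x = if a 0 = d 0 ∧ b 1 = d 1 ∧ c 2 = d 2 then 1 else 0 := by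
  classical
  rw [domeSum]
  refine if_congr ⟨?_, fun h => Or.inl ⟨![a, b, c, d], ?_, ?_⟩⟩ rfl rfl
  · rintro (⟨y, hy, h⟩ | ⟨z, hz, -⟩)
    · rw [hy] at h0 h1 h2 h3
      simp only [Sum.inl.injEq] at h0 h1 h2 h3
      subst h0 h1 h2 h3
      exact ⟨h 0, h 1, h 2⟩
    · simp [hz] at h0
  · simp [Fin.forall_fin_succ, h0, h1, h2, h3]
  · simpa [Fin.forall_fin_succ] using h

theorem domeSum_inr {α β : Type} [DecidableEq β] {x : Fin 4 → (Fin 3 → α) ⊕ β}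
    {a b c d : β} (h0 : x 0 = .inr a) (h1 : x 1 = .inr b) (h2 : x 2 = .inr c)
    (h3 : x 3 = .inr d) :
    domeSum α β x = if a = b ∧ b = c then 1 else 0 := by
  classical
  rw [domeSum]
  refine if_congr ⟨?_, fun h => Or.inr ⟨![a, b, c, d], ?_, ?_⟩⟩ rfl rfl
  · rintro (⟨y, hy, -⟩ | ⟨z, hz, h⟩)
    · simp [hy] at h0
    · rw [hz] at h0 h1 h2 h3
      simp only [Sum.inr.injEq] at h0 h1 h2 h3
      subst h0 h1 h2 h3
      exact h
  · simp [Fin.forall_fin_succ, h0, h1, h2, h3]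
  · simpa using h

theorem domeSum_mixed {α β : Type} {x : Fin 4 → (Fin 3 → α) ⊕ β} {v w : Fin 4}
    {a : Fin 3 → α} {b : β} (hv : x v = .inl a) (hw : x w = .inr b) : domeSum α β x = 0 := by
  rw [domeSum]
  refine if_neg ?_
  rintro (⟨y, hy, -⟩ | ⟨z, hz, -⟩)
  · simp [hy] at hw
  · simp [hz] at hv

/-! ### The degeneration to the direct sum. -/

section Degeneration

variable {α β : Type} [Fintype α] [DecidableEq α]

/-- The polynomial vectors of the degeneration to `domeSum α β`. -/
noncomputable def domeSumVector (u v w : α → α → α → β → ℂ) :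
    Option (α × α × α) → Fin 4 → (Fin 3 → α) ⊕ β → ℂ[X]
  | some (i, j, k) => ![
      Sum.elim (fun a => if a 0 = i then 1 else 0) (fun m => X * C (u i j k m)),
      Sum.elim (fun a => if a 1 = j then 1 else 0) (fun m => X * C (v i j k m)),
      Sum.elim (fun a => if a 2 = k then 1 else 0) (fun m => X * C (w i j k m)),
      Sum.elim (fun a => if a 0 = i then if a 1 = j then if a 2 = k then X ^ 3 else 0 else 0 else 0)
        (fun _ => 1)]
  | none => ![Sum.elim (fun _ => 1) (fun _ => 0), Sum.elim (fun _ => 1) (fun _ => 0),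
      Sum.elim (fun _ => 1) (fun _ => 0), Sum.elim (fun _ => 0) (fun _ => -1)]

/-- Schönhage's construction in order four. -/
theorem domeSum_degeneration [DecidableEq β] (u v w : α → α → α → β → ℂ)
    (hu : ∀ j k m, ∑ i, u i j k m = 0) (hv : ∀ i k m, ∑ j, v i j k m = 0)
    (hw : ∀ i j m, ∑ k, w i j k m = 0)
    (hvw : ∀ i m m', ∑ j, ∑ k, v i j k m * w i j k m' = 0)
    (huw : ∀ j m m', ∑ i, ∑ k, u i j k m * w i j k m' = 0)
    (huv : ∀ k m m', ∑ i, ∑ j, u i j k m * v i j k m' = 0)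
    (huvw : ∀ m m' m'', ∑ i, ∑ j, ∑ k, u i j k m * v i j k m' * w i j k m'' =
      if m = m' ∧ m' = m'' then 1 else 0)
    (x : Fin 4 → (Fin 3 → α) ⊕ β) :
    ∃ q : ℂ[X], ∑ j, ∏ t, domeSumVector u v w j t (x t) =
      X ^ 3 * (C (domeSum α β x) + X * q) := by
  have h₂ (p q : ℂ) : C p * X * (C q * X) = C (p * q) * X ^ 2 := by
    rw [C_mul]
    ring
  have h₃ (p q r : ℂ) : C p * X * (C q * X) * (C r * X) = C (p * q * r) * X ^ 3 := by
    rw [C_mul, C_mul]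
    ring
  simp only [Fin.prod_univ_four, Fintype.sum_option, Fintype.sum_prod_type, domeSumVector]
  rcases h3 : x 3 with d | d <;>
  rcases h0 : x 0 with a | a <;> rcases h1 : x 1 with b | b <;> rcases h2 : x 2 with c | c <;>
    simp [-mul_eq_mul_left_iff, -mul_eq_zero]
  -- With vertex `3` in the first summand, `X ^ 3` is already present and only the grid point `d`
  -- can survive. Any other vertex in the second summand adds a factor `X`, hence an error term.
  · rw [domeSum_inl h0 h1 h2 h3]
    refine ⟨0, ?_⟩
    by_cases e0 : a 0 = d 0 <;> by_cases e1 : b 1 = d 1 <;> by_cases e2 : c 2 = d 2 <;>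
      simp [e0, e1, e2]
  · rw [domeSum_mixed h3 h2]
    split_ifs
    exacts [⟨C (w (d 0) (d 1) (d 2) c), by rw [C_0]; ring⟩, ⟨0, by simp⟩, ⟨0, by simp⟩]
  · rw [domeSum_mixed h3 h1]
    split_ifs
    exacts [⟨C (v (d 0) (d 1) (d 2) b), by rw [C_0]; ring⟩, ⟨0, by simp⟩, ⟨0, by simp⟩]
  · rw [domeSum_mixed h3 h1]
    split_ifs
    exacts [⟨C (v (d 0) (d 1) (d 2) b) * C (w (d 0) (d 1) (d 2) c) * X, by rw [C_0]; ring⟩,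
      ⟨0, by simp⟩]
  · rw [domeSum_mixed h3 h0]
    split_ifs
    exacts [⟨C (u (d 0) (d 1) (d 2) a), by rw [C_0]; ring⟩, ⟨0, by simp⟩, ⟨0, by simp⟩]
  · rw [domeSum_mixed h3 h0]
    split_ifs
    exacts [⟨C (u (d 0) (d 1) (d 2) a) * C (w (d 0) (d 1) (d 2) c) * X, by rw [C_0]; ring⟩,
      ⟨0, by simp⟩]
  · rw [domeSum_mixed h3 h0]
    split_ifs
    exacts [⟨C (u (d 0) (d 1) (d 2) a) * C (v (d 0) (d 1) (d 2) b) * X, by rw [C_0]; ring⟩,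
      ⟨0, by simp⟩]
  · rw [domeSum_mixed h3 h0]
    exact ⟨C (u (d 0) (d 1) (d 2) a) * C (v (d 0) (d 1) (d 2) b) * C (w (d 0) (d 1) (d 2) c) *
      X ^ 2, by rw [C_0]; ring⟩
  -- With vertex `3` in the second summand, the degree is the number of other vertices there. Degree
  -- 0 is cancelled by the product `none`, degrees 1 and 2 by the line and plane sums; degree 3 is
  -- the unit tensor.
  · exact ⟨0, by simp [domeSum_mixed h0 h3]⟩
  · refine ⟨0, ?_⟩
    rw [domeSum_mixed h0 h3, ← Finset.sum_mul, ← map_sum, hw]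
    simp
  · refine ⟨0, ?_⟩
    rw [domeSum_mixed h0 h3, ← Finset.sum_mul, ← map_sum, hv]
    simp
  · refine ⟨0, ?_⟩
    simp_rw [domeSum_mixed h0 h3, h₂, ← Finset.sum_mul, ← map_sum, hvw]
    simp
  · refine ⟨0, ?_⟩
    rw [domeSum_mixed h1 h3, ← Finset.sum_mul, ← map_sum, hu]
    simp
  · refine ⟨0, ?_⟩
    simp_rw [domeSum_mixed h1 h3, h₂, ← Finset.sum_mul, ← map_sum, huw]
    simp
  · refine ⟨0, ?_⟩
    simp_rw [domeSum_mixed h2 h3, h₂, ← Finset.sum_mul, ← map_sum, huv]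
    simp
  · refine ⟨0, ?_⟩
    simp_rw [domeSum_inr h0 h1 h2 h3, h₃, ← Finset.sum_mul, ← map_sum, huvw]
    simp [mul_comm]

end Degeneration

/-! ### The choice of `u, v, w` on the grid. -/

section Cancellation

variable {q : ℕ}

/-- Grid points are grouped into cubes of side two. Each cube carries two summands of the unit
tensor, one for each parity class of its points. -/
def cubeIndicator (i j k : Fin q × Bool) (m : Fin q × Fin q × Fin q × Bool) : ℂ :=
  (if i.1 = m.1 then 1 else 0) * (if j.1 = m.2.1 then 1 else 0) *
    (if k.1 = m.2.2.1 then 1 else 0) * (if xor i.2 (xor j.2 k.2) = m.2.2.2 then 1 else 0)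

/-- `(-1) ^ s`. -/
def boolSign (s : Bool) : ℂ := if s then -1 else 1

/-- Extends a function on the grid by a layer in the first direction, so that sums in that
direction vanish. -/
noncomputable def balanceFirst {δ β : Type} [Fintype δ] (f : δ → δ → δ → β → ℂ) :
    Option δ → Option δ → Option δ → β → ℂ
  | some i, some j, some k, m => f i j k m
  | none, some j, some k, m => -∑ i, f i j k m
  | _, _, _, _ => 0

/-- Extends a function on the grid by a layer in the second direction, so that sums in that
direction vanish. -/
noncomputable def balanceSecond {δ β : Type} [Fintype δ] (f : δ → δ → δ → β → ℂ) :
    Option δ → Option δ → Option δ → β → ℂ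
  | some i, some j, some k, m => f i j k m
  | some i, none, some k, m => -∑ j, f i j k m
  | _, _, _, _ => 0

/-- Extends a function on the grid by a layer in the third direction, so that sums in that
direction vanish. -/
noncomputable def balanceThird {δ β : Type} [Fintype δ] (f : δ → δ → δ → β → ℂ) :
    Option δ → Option δ → Option δ → β → ℂ
  | some i, some j, some k, m => f i j k m
  | some i, some j, none, m => -∑ k, f i j k m
  | _, _, _, _ => 0

theorem sum_balanceFirst {δ β : Type} [Fintype δ] (f : δ → δ → δ → β → ℂ) (j k m) :
    ∑ i, balanceFirst f i j k m = 0 := by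
  cases j <;> cases k <;> simp [Fintype.sum_option, balanceFirst]

theorem sum_balanceSecond {δ β : Type} [Fintype δ] (f : δ → δ → δ → β → ℂ) (i k m) :
    ∑ j, balanceSecond f i j k m = 0 := by
  cases i <;> cases k <;> simp [Fintype.sum_option, balanceSecond]

theorem sum_balanceThird {δ β : Type} [Fintype δ] (f : δ → δ → δ → β → ℂ) (i j m) :
    ∑ k, balanceThird f i j k m = 0 := by
  cases i <;> cases j <;> simp [Fintype.sum_option, balanceThird]

/-- On a parity class, `v` and `w` are the signs of the first two coordinate bits and `u = v * w /
4`. Distinct classes are disjoint. Fixing one coordinate leaves at most two points of a class, at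
which the product of the two functions has opposite signs; this also gives the next two sums. -/
theorem sum_cubeIndicator_first (i : Fin q × Bool) (m m' : Fin q × Fin q × Fin q × Bool) :
    ∑ j, ∑ k, (cubeIndicator i j k m * boolSign i.2) * (cubeIndicator i j k m' * boolSign j.2) =
      0 := by
  obtain ⟨i, s⟩ := i
  obtain ⟨a, b, c, p⟩ := m
  obtain ⟨a', b', c', p'⟩ := m'
  simp only [Fintype.sum_prod_type, Fintype.sum_bool, cubeIndicator, boolSign]
  cases s <;> cases p <;> cases p' <;> simp

theorem sum_cubeIndicator_second (j : Fin q × Bool) (m m' : Fin q × Fin q × Fin q × Bool) :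
    ∑ i, ∑ k, (cubeIndicator i j k m * (boolSign k.2 * boolSign m.2.2.2 / 4)) *
      (cubeIndicator i j k m' * boolSign j.2) = 0 := by
  obtain ⟨j, s⟩ := j
  obtain ⟨a, b, c, p⟩ := m
  obtain ⟨a', b', c', p'⟩ := m'
  simp only [Fintype.sum_prod_type, Fintype.sum_bool, cubeIndicator, boolSign]
  cases s <;> cases p <;> cases p' <;> simp
  all_goals
    refine Finset.sum_eq_zero fun x _ => ?_
    split_ifs <;> norm_num

theorem sum_cubeIndicator_third (k : Fin q × Bool) (m m' : Fin q × Fin q × Fin q × Bool) :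
    ∑ i, ∑ j, (cubeIndicator i j k m * (boolSign k.2 * boolSign m.2.2.2 / 4)) *
      (cubeIndicator i j k m' * boolSign i.2) = 0 := by
  obtain ⟨k, s⟩ := k
  obtain ⟨a, b, c, p⟩ := m
  obtain ⟨a', b', c', p'⟩ := m'
  simp only [Fintype.sum_prod_type, Fintype.sum_bool, cubeIndicator, boolSign]
  cases s <;> cases p <;> cases p' <;> simp

theorem cubeIndicator_eq (i j k : Fin q × Bool) (m : Fin q × Fin q × Fin q × Bool) :
    cubeIndicator i j k m =
      if (i.1, j.1, k.1, xor i.2 (xor j.2 k.2)) = m then 1 else 0 := by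
  obtain ⟨a, b, c, p⟩ := m
  simp only [cubeIndicator, Prod.mk.injEq, ite_and]
  split_ifs <;> simp

theorem sum_cubeIndicator (m : Fin q × Fin q × Fin q × Bool) :
    ∑ i, ∑ j, ∑ k, cubeIndicator i j k m = 4 := by
  obtain ⟨a, b, c, p⟩ := m
  simp only [Fintype.sum_prod_type, Fintype.sum_bool, cubeIndicator]
  cases p <;> simp [Finset.sum_add_distrib] <;> norm_num

/-- The sign of the class is the product of the three bit signs, so every sign is squared. Each of
the four points of a class contributes `1 / 4`. -/
theorem cubeIndicator_mul (i j k : Fin q × Bool) (m m' m'' : Fin q × Fin q × Fin q × Bool) :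
    (cubeIndicator i j k m * (boolSign k.2 * boolSign m.2.2.2 / 4)) *
      (cubeIndicator i j k m' * boolSign i.2) * (cubeIndicator i j k m'' * boolSign j.2) =
      cubeIndicator i j k m * ((if m = m' ∧ m' = m'' then 1 else 0) / 4) := by
  have hsign : ∀ s t r : Bool, boolSign r * boolSign (xor s (xor t r)) * boolSign s * boolSign t =
      1 := by
    intro s t r
    cases s <;> cases t <;> cases r <;> simp [boolSign]
  simp only [cubeIndicator_eq]
  by_cases h : (i.1, j.1, k.1, xor i.2 (xor j.2 k.2)) = m
  · subst h
    by_cases h' : (i.1, j.1, k.1, xor i.2 (xor j.2 k.2)) = m'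
    · subst h'
      simp only [if_true, true_and]
      split_ifs
      · linear_combination hsign i.2 j.2 k.2 / 4
      · simp
    · simp [h']
  · simp [h]

theorem sum_cubeIndicator_all (m m' m'' : Fin q × Fin q × Fin q × Bool) :
    ∑ i, ∑ j, ∑ k, (cubeIndicator i j k m * (boolSign k.2 * boolSign m.2.2.2 / 4)) *
      (cubeIndicator i j k m' * boolSign i.2) * (cubeIndicator i j k m'' * boolSign j.2) =
      if m = m' ∧ m' = m'' then 1 else 0 := by
  simp only [cubeIndicator_mul, ← Finset.sum_mul, sum_cubeIndicator]
  ring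

/-- The direct sum of `Dome(n + 1; 1)` and `Dome(1; n ^ 3 / 4)` has border rank at most
`(n + 1) ^ 3 + 1`. -/
theorem rankLE_kroneckerPow_domeSum (q N : ℕ) :
    RankLE (kroneckerPow (domeSum (Option (Fin q × Bool)) (Fin q × Fin q × Fin q × Bool)) N)
      (((2 * q + 1) ^ 3 + 1) ^ N * (3 * N + 1) ^ 4) := by
  have h := RankLE.kroneckerPow_of_degeneration
    (domeSumVector
      (balanceFirst fun i j k (m : Fin q × Fin q × Fin q × Bool) =>
        cubeIndicator i j k m * (boolSign k.2 * boolSign m.2.2.2 / 4))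
      (balanceSecond fun i j k m => cubeIndicator i j k m * boolSign i.2)
      (balanceThird fun i j k m => cubeIndicator i j k m * boolSign j.2)) 3
    (domeSum_degeneration _ _ _ (sum_balanceFirst _) (sum_balanceSecond _) (sum_balanceThird _)
      ?_ ?_ ?_ ?_) N
  · have hcard : Fintype.card (Option (Option (Fin q × Bool) × Option (Fin q × Bool) ×
        Option (Fin q × Bool))) = (2 * q + 1) ^ 3 + 1 := by
      simp
      ring
    rwa [hcard, Fintype.card_fin] at h
  -- The layers added to `u`, `v` and `w` are pairwise disjoint, so products of two of them live on
  -- the original grid and the plane sums are unchanged.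
  · rintro (_ | i) m m'
    · simp [balanceSecond, balanceThird]
    · simpa [Fintype.sum_option, balanceSecond, balanceThird] using
        sum_cubeIndicator_first i m m'
  · rintro (_ | j) m m'
    · simp [balanceFirst, balanceThird]
    · simpa [Fintype.sum_option, balanceFirst, balanceThird] using
        sum_cubeIndicator_second j m m'
  · rintro (_ | k) m m'
    · simp [balanceFirst, balanceSecond]
    · simpa [Fintype.sum_option, balanceFirst, balanceSecond] using
        sum_cubeIndicator_third k m m'
  · intro m m' m''
    simpa [Fintype.sum_option, balanceFirst, balanceSecond, balanceThird] using
      sum_cubeIndicator_all m m' m''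

end Cancellation

theorem ite_one_zero_congr {p q : Prop} {_ : Decidable p} {_ : Decidable q} (h : p ↔ q) :
    (if p then (1 : ℂ) else 0) = if q then 1 else 0 := by
  simp only [h]

/-! ### Disjoint copies of a dome tensor in a power of the direct sum. -/

section Copies

theorem copies_apply {V : Type} [Fintype V] {ι : V → Type} {Γ : Type} [Fintype Γ] [DecidableEq Γ]
    (T : CTensor ι) (v₀ : V) (x : ∀ v, Γ × ι v) :
    copies Γ T x = if ∀ v, (x v).1 = (x v₀).1 then T (fun v => (x v).2) else 0 := by
  rw [copies, Finset.sum_eq_single (x v₀).1]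
  · simp [Finset.prod_boole]
  · intro γ _ h
    rw [Finset.prod_eq_zero (Finset.mem_univ v₀) (if_neg h.symm), zero_mul]
  · simp

variable {α β : Type} {k l : ℕ}

/-- Places a word over `α` on the positions in `γ` and a word over `β` on the other positions. -/
noncomputable def interleave (γ : {S : Finset (Fin (k + l)) // S.card = k})
    (y : (Fin 3 → Fin k → α) × (Fin l → β)) (t : Fin (k + l)) : (Fin 3 → α) ⊕ β :=
  if h : t ∈ γ.1 then .inl fun i => y.1 i (γ.1.equivFinOfCardEq γ.2 ⟨t, h⟩)
  else .inr (y.2 (Finset.equivFinOfCardEq (s := γ.1ᶜ) (n := l)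
    (by rw [Finset.card_compl, γ.2, Fintype.card_fin, Nat.add_sub_cancel_left])
    ⟨t, Finset.mem_compl.2 h⟩))

theorem interleave_of_mem {γ : {S : Finset (Fin (k + l)) // S.card = k}} {t : Fin (k + l)}
    (h : t ∈ γ.1) (y : (Fin 3 → Fin k → α) × (Fin l → β)) :
    interleave γ y t = .inl fun i => y.1 i (γ.1.equivFinOfCardEq γ.2 ⟨t, h⟩) :=
  dif_pos h

theorem interleave_of_notMem {γ : {S : Finset (Fin (k + l)) // S.card = k}} {t : Fin (k + l)}
    (h : t ∉ γ.1) (y : (Fin 3 → Fin k → α) × (Fin l → β)) :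
    interleave γ y t = .inr (y.2 (Finset.equivFinOfCardEq (s := γ.1ᶜ) (n := l)
      (by rw [Finset.card_compl, γ.2, Fintype.card_fin, Nat.add_sub_cancel_left])
      ⟨t, Finset.mem_compl.2 h⟩)) :=
  dif_neg h

theorem domeSumSupport_interleave_iff (γ : {S : Finset (Fin (k + l)) // S.card = k})
    (y : Fin 4 → (Fin 3 → Fin k → α) × (Fin l → β)) :
    (∀ t, DomeSumSupport fun v => interleave γ (y v) t) ↔
      (∀ i : Fin 3, (y i.castSucc).1 i = (y 3).1 i) ∧ (y 0).2 = (y 1).2 ∧ (y 1).2 = (y 2).2 := by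
  constructor
  · intro h
    have hα (i : Fin 3) : (y i.castSucc).1 i = (y 3).1 i := by
      funext s
      obtain ⟨⟨t, ht⟩, rfl⟩ := (γ.1.equivFinOfCardEq γ.2).surjective s
      rcases h t with ⟨z, hz, hz'⟩ | ⟨z, hz, -⟩
      · simp only [interleave_of_mem ht, Sum.inl.injEq] at hz
        have := hz' i
        rwa [← hz, ← hz] at this
      · simp [interleave_of_mem ht] at hz
    have hβ : (y 0).2 = (y 1).2 ∧ (y 1).2 = (y 2).2 := by
      simp only [funext_iff, ← forall_and]
      intro s
      obtain ⟨⟨t, ht⟩, rfl⟩ := (Finset.equivFinOfCardEq (s := γ.1ᶜ) (n := l)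
        (by rw [Finset.card_compl, γ.2, Fintype.card_fin, Nat.add_sub_cancel_left])).surjective s
      have ht' := Finset.mem_compl.1 ht
      rcases h t with ⟨z, hz, -⟩ | ⟨z, hz, hz'⟩
      · simp [interleave_of_notMem ht'] at hz
      · simp only [interleave_of_notMem ht', Sum.inr.injEq] at hz
        rwa [← hz, ← hz, ← hz] at hz'
    exact ⟨hα, hβ⟩
  · rintro ⟨hα, hβ, hβ'⟩ t
    by_cases ht : t ∈ γ.1
    · exact Or.inl ⟨_, fun v => interleave_of_mem ht (y v), fun i => by rw [hα]⟩
    · exact Or.inr ⟨_, fun v => interleave_of_notMem ht (y v), by rw [hβ], by rw [hβ']⟩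

/-- Disjointness of the copies: at each position all four vertices must lie in the same summand. -/
theorem eq_of_domeSumSupport_interleave {γ : Fin 4 → {S : Finset (Fin (k + l)) // S.card = k}}
    {y : Fin 4 → (Fin 3 → Fin k → α) × (Fin l → β)}
    (h : ∀ t, DomeSumSupport fun v => interleave (γ v) (y v) t) (v w : Fin 4) : γ v = γ w := by
  have hsub (v w : Fin 4) (t : Fin (k + l)) (ht : t ∈ (γ v).1) : t ∈ (γ w).1 := by
    by_contra hw
    rcases h t with ⟨z, hz, -⟩ | ⟨z, hz, -⟩
    · have := hz w
      simp [interleave_of_notMem hw] at this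
    · have := hz v
      simp [interleave_of_mem ht] at this
  exact Subtype.ext (Finset.ext fun t => ⟨hsub v w t, hsub w v t⟩)

/-- The power `k + l` of the direct sum of `Dome(α; 1)` and `Dome(1; β)` contains one copy of
`Dome(α ^ k; β ^ l)` for every set of `k` positions. -/
theorem restricts_copies_domeOn [DecidableEq α] [DecidableEq β] :
    Restricts (copies {S : Finset (Fin (k + l)) // S.card = k} (domeOn (Fin k → α) (Fin l → β)))
      (kroneckerPow (domeSum α β) (k + l)) := by
  classical
  refine ⟨fun _ y => interleave y.1 y.2, fun x => ?_⟩
  have hpow : kroneckerPow (domeSum α β) (k + l) (fun v => interleave (x v).1 (x v).2) =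
      if ∀ t, DomeSumSupport fun v => interleave (x v).1 (x v).2 t then 1 else 0 := by
    simp only [kroneckerPow, kronecker, domeSum]
    rw [Finset.prod_boole]
    simp
  rw [hpow, copies_apply _ 0, domeOn, ← ite_and]
  refine ite_one_zero_congr ⟨?_, fun h => ?_⟩
  · rintro ⟨h, h'⟩
    simp only [h]
    exact (domeSumSupport_interleave_iff (x 0).1 fun v => (x v).2).2 h'
  · have heq (v : Fin 4) : (x v).1 = (x 0).1 := eq_of_domeSumSupport_interleave h v 0
    simp only [heq] at h
    exact ⟨heq, (domeSumSupport_interleave_iff (x 0).1 fun v => (x v).2).1 h⟩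

end Copies

/-! ### Powers of dome tensors and comparison with `domeTensor`. -/

section Dome

variable {α β : Type} [DecidableEq α] [DecidableEq β]

theorem restricts_domeOn {α' β' : Type} [DecidableEq α'] [DecidableEq β'] (f : α' ↪ α)
    (g : β' ↪ β) : Restricts (domeOn α' β') (domeOn α β) :=
  ⟨fun _ y => (fun i => f (y.1 i), g y.2), fun x => by
    simp [domeOn, f.injective.eq_iff, g.injective.eq_iff]⟩

theorem restricts_domeOn_kroneckerPow (s : ℕ) :
    Restricts (domeOn (Fin s → α) (Fin s → β)) (kroneckerPow (domeOn α β) s) := by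
  refine ⟨fun _ y t => (fun i => y.1 i t, y.2 t), fun x => ?_⟩
  simp only [kroneckerPow, kronecker, domeOn]
  rw [Finset.prod_boole]
  refine ite_one_zero_congr ?_
  simp only [funext_iff, Finset.mem_univ, true_imp_iff, forall_and]
  rw [forall_comm]

theorem kroneckerPow_domeOn_restricts (s : ℕ) :
    Restricts (kroneckerPow (domeOn α β) s) (domeOn (Fin s → α) (Fin s → β)) := by
  refine ⟨fun _ y => (fun i t => (y t).1 i, fun t => (y t).2), fun x => ?_⟩
  simp only [kroneckerPow, kronecker, domeOn]
  rw [Finset.prod_boole]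
  refine ite_one_zero_congr ?_
  simp only [funext_iff, Finset.mem_univ, true_imp_iff, forall_and]
  rw [forall_comm]

theorem edgeTensor_apply {V : Type} [Fintype V] [DecidableEq V] (I : Finset V) (m : ℕ) {v₀ : V}
    (h₀ : v₀ ∈ I) (x : ∀ v : V, v ∈ I → Fin m) :
    edgeTensor I m x = if ∀ v h, x v h = x v₀ h₀ then 1 else 0 := by
  rw [edgeTensor, Finset.sum_eq_single (x v₀ h₀)]
  · rw [Finset.prod_boole]
    simp
  · intro j _ hj
    exact Finset.prod_eq_zero (Finset.mem_univ v₀) (if_neg fun h => hj (h h₀).symm)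
  · simp

theorem domeTensor_restricts (a b : ℕ) [NeZero a] [NeZero b] :
    Restricts (domeTensor a a a b) (domeOn (Fin a) (Fin b)) := by
  -- Labels of edges not incident to `v` are never read, so `0` serves as a filler; this needs
  -- nonzero weights.
  refine ⟨fun v y =>
    (![if h : v ∈ domeEdge 0 then y 0 h else (0 : Fin a),
      if h : v ∈ domeEdge 1 then y 1 h else (0 : Fin a),
      if h : v ∈ domeEdge 2 then y 2 h else (0 : Fin a)],
      if h : v ∈ domeEdge 3 then y 3 h else (0 : Fin b)), fun x => ?_⟩
  have h₀ : (∀ v (h : v ∈ domeEdge 0), x v 0 h = x 3 0 (by decide)) ↔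
      x 0 0 (by decide) = x 3 0 (by decide) :=
    ⟨fun h => h 0 (by decide), fun h v hv => match v, hv with
      | 0, _ => h
      | 1, hv => absurd hv (by decide)
      | 2, hv => absurd hv (by decide)
      | 3, _ => rfl⟩
  have h₁ : (∀ v (h : v ∈ domeEdge 1), x v 1 h = x 3 1 (by decide)) ↔
      x 1 1 (by decide) = x 3 1 (by decide) :=
    ⟨fun h => h 1 (by decide), fun h v hv => match v, hv with
      | 0, hv => absurd hv (by decide)
      | 1, _ => h
      | 2, hv => absurd hv (by decide)
      | 3, _ => rfl⟩
  have h₂ : (∀ v (h : v ∈ domeEdge 2), x v 2 h = x 3 2 (by decide)) ↔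
      x 2 2 (by decide) = x 3 2 (by decide) :=
    ⟨fun h => h 2 (by decide), fun h v hv => match v, hv with
      | 0, hv => absurd hv (by decide)
      | 1, hv => absurd hv (by decide)
      | 2, _ => h
      | 3, _ => rfl⟩
  have h₃ : (∀ v (h : v ∈ domeEdge 3), x v 3 h = x 1 3 (by decide)) ↔
      x 0 3 (by decide) = x 1 3 (by decide) ∧ x 1 3 (by decide) = x 2 3 (by decide) :=
    ⟨fun h => ⟨h 0 (by decide), (h 2 (by decide)).symm⟩, fun h v hv => match v, hv with
      | 0, _ => h.1
      | 1, _ => rfl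
      | 2, _ => h.2.symm
      | 3, hv => absurd hv (by decide)⟩
  rw [domeTensor, graphTensor, kronecker, Fin.prod_univ_four,
    edgeTensor_apply (domeEdge 0) _ (v₀ := 3) (by decide),
    edgeTensor_apply (domeEdge 1) _ (v₀ := 3) (by decide),
    edgeTensor_apply (domeEdge 2) _ (v₀ := 3) (by decide),
    edgeTensor_apply (domeEdge 3) _ (v₀ := 1) (by decide)]
  simp only [h₀, h₁, h₂, h₃, mul_ite, mul_one, mul_zero, ← ite_and]
  rw [domeOn]
  refine ite_one_zero_congr ?_
  rw [Fin.forall_fin_succ, Fin.forall_fin_succ, Fin.forall_fin_succ]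
  change _ ↔ ((x 0 0 _ = x 3 0 _ ∧ x 1 1 _ = x 3 1 _ ∧ x 2 2 _ = x 3 2 _ ∧ _) ∧
    x 0 3 _ = x 1 3 _ ∧ x 1 3 _ = x 2 3 _)
  simp only [Fin.forall_fin_zero, and_true]
  tauto

end Dome

open Filter Topology

/-! ### Entropy bound for binomial coefficients. -/

section Binomial

/-- The terms of the expansion of `(k + l) ^ (k + l)` are largest at the exponent `k`. -/
theorem choose_mul_pow_le {k l : ℕ} (hl : 0 < l) {j : ℕ} (hj : j ≤ k + l) :
    (k + l).choose j * k ^ j * l ^ (k + l - j) ≤ (k + l).choose k * k ^ k * l ^ l := by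
  set t : ℕ → ℕ := fun j => (k + l).choose j * k ^ j * l ^ (k + l - j) with ht
  -- The ratio of consecutive terms is `(k+l-j) k / ((j+1) l)`, at least 1 for `j < k` and at most 1
  -- for `j ≥ k`.
  have hstep (j : ℕ) (hj : j < k + l) : t (j + 1) * ((j + 1) * l) = t j * ((k + l - j) * k) := by
    have h := Nat.choose_succ_right_eq (k + l) j
    have h' : k + l - j = k + l - (j + 1) + 1 := by omega
    simp only [ht]
    rw [h', pow_succ, pow_succ, ← h']
    calc _ = (k + l).choose (j + 1) * (j + 1) * (k ^ j * k * l ^ (k + l - (j + 1)) * l) := by ring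
      _ = _ := by rw [h]; ring
  have hup (j : ℕ) (hj : j < k) : t j ≤ t (j + 1) := by
    refine Nat.le_of_mul_le_mul_right ?_ (Nat.mul_pos j.succ_pos hl)
    rw [hstep j (by omega), mul_comm (k + l - j)]
    exact Nat.mul_le_mul_left _ (Nat.mul_le_mul (by omega) (by omega))
  have hdown (j : ℕ) (hj : k ≤ j) (hj' : j < k + l) : t (j + 1) ≤ t j := by
    refine Nat.le_of_mul_le_mul_right ?_ (Nat.mul_pos j.succ_pos hl)
    rw [hstep j hj', mul_comm (k + l - j)]
    exact Nat.mul_le_mul_left _ (Nat.mul_le_mul (by omega) (by omega))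
  have hk' : (k + l).choose k * k ^ k * l ^ l = t k := by simp [ht]
  rw [hk']
  change t j ≤ t k
  rcases le_total j k with h | h
  · have (m : ℕ) (hjm : j ≤ m) : m ≤ k → t j ≤ t m := by
      induction m, hjm using Nat.le_induction with
      | base => exact fun _ => le_rfl
      | succ m _ ih => exact fun hm => (ih (by omega)).trans (hup m (by omega))
    exact this k h le_rfl
  · have (m : ℕ) (hkm : k ≤ m) : m ≤ k + l → t m ≤ t k := by
      induction m, hkm using Nat.le_induction with
      | base => exact fun _ => le_rfl
      | succ m hm ih => exact fun hm' => (hdown m hm (by omega)).trans (ih (by omega))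
    exact this j h hj

/-- The binomial expansion has `k + l + 1` terms, none above the one at `k`. Taking logarithms gives
the entropy bound. -/
theorem add_pow_add_le_choose {k l : ℕ} (hl : 0 < l) :
    (k + l) ^ (k + l) ≤ (k + l + 1) * ((k + l).choose k * k ^ k * l ^ l) := by
  rw [add_pow k l (k + l)]
  refine (Finset.sum_le_card_nsmul _ _ ((k + l).choose k * k ^ k * l ^ l) fun j hj => ?_).trans
    (by simp)
  refine le_trans (le_of_eq ?_) (choose_mul_pow_le hl
    (Nat.lt_succ_iff.1 (Finset.mem_range.1 hj)))
  simp only [Nat.cast_id]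
  ring

theorem binaryEntropy_eq_div (p : ℝ) : binaryEntropy p = Real.binEntropy p / Real.log 2 := by
  simp only [binaryEntropy, Real.binEntropy, Real.logb, Real.log_inv]
  ring

theorem binaryEntropy_le_one (p : ℝ) : binaryEntropy p ≤ 1 := by
  rw [binaryEntropy_eq_div]
  exact (div_le_one (Real.log_pos one_lt_two)).2 Real.binEntropy_le_log_two

theorem continuous_binaryEntropy : Continuous binaryEntropy := by
  rw [funext binaryEntropy_eq_div]
  exact Real.binEntropy_continuous.div_const _

theorem two_rpow_binaryEntropy_le_choose {k l : ℕ} (hk : 0 < k) (hl : 0 < l) :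
    (2 : ℝ) ^ (((k + l : ℕ) : ℝ) * binaryEntropy (k / ((k + l : ℕ) : ℝ))) ≤
      ((k + l : ℕ) + 1) * (k + l).choose k := by
  have hk' : (0 : ℝ) < k := Nat.cast_pos.2 hk
  have hl' : (0 : ℝ) < l := Nat.cast_pos.2 hl
  have hC : (0 : ℝ) < (k + l).choose k := Nat.cast_pos.2 (Nat.choose_pos (Nat.le_add_right _ _))
  have h2 : (0 : ℝ) < Real.log 2 := Real.log_pos one_lt_two
  have h : ((k : ℝ) + l) ^ (k + l) ≤ (k + l + 1) * ((k + l).choose k * k ^ k * l ^ l) := by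
    exact_mod_cast add_pow_add_le_choose hl
  have hlog := Real.log_le_log (by positivity) h
  rw [Real.log_pow, Real.log_mul (by positivity) (by positivity),
    Real.log_mul (by positivity) (by positivity), Real.log_mul (by positivity) (by positivity),
    Real.log_pow, Real.log_pow] at hlog
  rw [← Real.log_le_log_iff (by positivity) (by positivity), Real.log_rpow two_pos,
    Real.log_mul (by positivity) (by positivity), binaryEntropy_eq_div]
  have h1 : 1 - (k : ℝ) / (k + l) = l / (k + l) := by
    field_simp
    ring
  have hent : ((k : ℝ) + l) * Real.binEntropy (k / (k + l)) =
      (k + l) * Real.log (k + l) - k * Real.log k - l * Real.log l := by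
    rw [Real.binEntropy, h1, Real.log_inv, Real.log_inv, Real.log_div (by positivity) (by positivity),
      Real.log_div (by positivity) (by positivity)]
    field_simp
    ring
  push_cast at hlog ⊢
  rw [mul_assoc, div_mul_cancel₀ _ h2.ne', hent]
  linarith

end Binomial

/-! ### Choice of one good power. -/

section Block

theorem tendsto_log_linear_div : Tendsto (fun N : ℕ => Real.log (3 * N + 7) / N) atTop (𝓝 0) := by
  have h := Real.tendsto_pow_log_div_mul_add_atTop (1 / 3) (-7 / 3) 1 (by norm_num)
  have h' : Tendsto (fun N : ℕ => (3 * N + 7 : ℝ)) atTop atTop :=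
    tendsto_atTop_add_const_right _ _
      (tendsto_natCast_atTop_atTop.const_mul_atTop (by norm_num))
  refine (h.comp h').congr fun N => ?_
  simp only [Function.comp, pow_one]
  congr 1
  ring

/-- A single power of the direct sum for which the number of products per copy is close to
`2 ^ (N₀ * (log R - h(p)))`. -/
theorem exists_block {R : ℕ} (hR : 2 ≤ R) {p : ℝ} (hp0 : 0 < p) (hp1 : p < 1) {δ : ℝ}
    (hδ : 0 < δ) :
    ∃ N₀ k l c : ℕ, 0 < N₀ ∧ p * N₀ ≤ k ∧ (1 - p) * N₀ ≤ l ∧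
      R ^ (k + l) * (3 * (k + l) + 1) ^ 4 ≤ c * (k + l).choose k ∧
      (c : ℝ) ≤ 2 ^ (N₀ * (Real.logb 2 R - binaryEntropy p + δ)) := by
  have hR' : (2 : ℝ) ≤ R := by exact_mod_cast hR
  have hp1' : 0 < 1 - p := sub_pos.2 hp1
  set k : ℕ → ℕ := fun N => ⌈p * N⌉₊ with hk
  set l : ℕ → ℕ := fun N => ⌈(1 - p) * N⌉₊ with hl
  set L := Real.logb 2 R with hL
  have hL1 : 1 ≤ L := (Real.le_logb_iff_rpow_le one_lt_two (by linarith)).2 (by simpa using hR')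
  have hkN : Tendsto (fun N : ℕ => (k N : ℝ) / N) atTop (𝓝 p) :=
    (tendsto_nat_ceil_mul_div_atTop hp0.le).comp tendsto_natCast_atTop_atTop
  have hlN : Tendsto (fun N : ℕ => (l N : ℝ) / N) atTop (𝓝 (1 - p)) :=
    (tendsto_nat_ceil_mul_div_atTop hp1'.le).comp tendsto_natCast_atTop_atTop
  have hsum : Tendsto (fun N : ℕ => ((k N + l N : ℕ) : ℝ) / N) atTop (𝓝 1) := by
    have := hkN.add hlN
    rw [add_sub_cancel] at this
    refine this.congr fun N => ?_
    push_cast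
    ring
  have hratio : Tendsto (fun N : ℕ => (k N : ℝ) / ((k N + l N : ℕ) : ℝ)) atTop (𝓝 p) := by
    have := hkN.div hsum one_ne_zero
    rw [div_one] at this
    refine this.congr' ?_
    filter_upwards [eventually_gt_atTop 0] with N hN
    have : (N : ℝ) ≠ 0 := by positivity
    exact div_div_div_cancel_right₀ this _ _
  -- The three terms are the exponents, per unit of `N`, of a factor 2 for rounding up `c`, of the
  -- polynomial losses `(3N+7)^5`, and of the main term.
  have hlim : Tendsto (fun N : ℕ => (1 : ℝ) / N + 5 / Real.log 2 * (Real.log (3 * N + 7) / N) +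
      ((k N + l N : ℕ) : ℝ) / N * (L - binaryEntropy (k N / ((k N + l N : ℕ) : ℝ)))) atTop
      (𝓝 (L - binaryEntropy p)) := by
    have h := ((tendsto_const_div_atTop_nhds_zero_nat (1 : ℝ)).add
      (tendsto_log_linear_div.const_mul (5 / Real.log 2))).add
      (hsum.mul (((continuous_binaryEntropy.tendsto p).comp hratio).const_sub L))
    simpa using h
  obtain ⟨N, hN, hN0⟩ := ((hlim.eventually_lt_const (lt_add_of_pos_right _ hδ)).and
    (eventually_gt_atTop 0)).exists
  have hN0' : (0 : ℝ) < N := Nat.cast_pos.2 hN0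
  have hkpos : 0 < k N := Nat.ceil_pos.2 (by positivity)
  have hlpos : 0 < l N := Nat.ceil_pos.2 (by positivity)
  have hC : (0 : ℝ) < (k N + l N).choose (k N) :=
    Nat.cast_pos.2 (Nat.choose_pos (Nat.le_add_right _ _))
  set n := k N + l N with hn
  have hnN : (n : ℝ) ≤ N + 2 := by
    have h1 := (Nat.ceil_lt_add_one (a := p * N) (by positivity)).le
    have h2 := (Nat.ceil_lt_add_one (a := (1 - p) * N) (by positivity)).le
    simp only [hn, hk, hl, Nat.cast_add]
    linarith
  set e := binaryEntropy (k N / (n : ℝ)) with he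
  set Z : ℝ := (R : ℝ) ^ n * (3 * n + 1) ^ 4 / n.choose (k N) with hZ
  -- Since `n ≤ N + 2`, the base `3N + 7` bounds both `3n + 1`, occurring four times through the
  -- degeneration, and `n + 1` from the binomial estimate.
  set Y : ℝ := (3 * N + 7) ^ 5 * 2 ^ (n * (L - e)) with hY
  have hchoose : (2 : ℝ) ^ (n * e) ≤ (n + 1) * n.choose (k N) :=
    two_rpow_binaryEntropy_le_choose hkpos hlpos
  have hRn : (R : ℝ) ^ n = 2 ^ (n * L) := by
    rw [mul_comm, Real.rpow_mul two_pos.le, hL, Real.rpow_logb two_pos (by norm_num) (by linarith),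
      Real.rpow_natCast]
  have hZY : Z ≤ Y := by
    rw [hZ, div_le_iff₀ hC, hRn, hY]
    have h1 : (2 : ℝ) ^ (n * L) = 2 ^ (n * (L - e)) * 2 ^ (n * e) := by
      rw [← Real.rpow_add two_pos]
      ring_nf
    have h2 : (3 * (n : ℝ) + 1) ^ 4 * (n + 1) ≤ (3 * N + 7) ^ 5 := by
      rw [pow_succ (3 * (N : ℝ) + 7) 4]
      exact mul_le_mul (pow_le_pow_left₀ (by positivity) (by linarith) 4) (by linarith)
        (by positivity) (by positivity)
    calc (2 : ℝ) ^ (n * L) * (3 * n + 1) ^ 4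
        ≤ 2 ^ (n * (L - e)) * ((n + 1) * n.choose (k N)) * (3 * n + 1) ^ 4 := by
          rw [h1]
          gcongr
      _ = ((3 * (n : ℝ) + 1) ^ 4 * (n + 1)) * 2 ^ (n * (L - e)) * n.choose (k N) := by ring
      _ ≤ _ := by gcongr
  -- Lets `2 * Y` absorb the 1 lost in rounding up `Z`.
  have hY1 : 1 ≤ Y := by
    refine one_le_mul_of_one_le_of_one_le (one_le_pow₀ (by linarith)) ?_
    refine Real.one_le_rpow one_le_two (mul_nonneg (Nat.cast_nonneg _) ?_)
    linarith [binaryEntropy_le_one (k N / (n : ℝ))]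
  refine ⟨N, k N, l N, ⌈Z⌉₊, hN0, Nat.le_ceil _, Nat.le_ceil _, ?_, ?_⟩
  · have h := Nat.le_ceil Z
    generalize ⌈Z⌉₊ = c at h
    rw [hZ, div_le_iff₀ hC] at h
    change R ^ n * (3 * n + 1) ^ 4 ≤ c * n.choose (k N)
    exact_mod_cast h
  · have hZ0 : 0 ≤ Z := by positivity
    calc (⌈Z⌉₊ : ℝ) ≤ Z + 1 := (Nat.ceil_lt_add_one hZ0).le
      _ ≤ 2 * Y := by linarith
      _ = 2 ^ (1 + 5 / Real.log 2 * Real.log (3 * N + 7) + n * (L - e)) := by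
        have hlog : 5 / Real.log 2 * Real.log (3 * N + 7) = Real.logb 2 (3 * N + 7) * 5 := by
          rw [Real.logb]
          ring
        rw [Real.rpow_add two_pos, Real.rpow_add two_pos, Real.rpow_one, hY, ← mul_assoc, hlog,
          Real.rpow_mul two_pos.le (Real.logb _ _), Real.rpow_logb two_pos (by norm_num) (by positivity),
          Real.rpow_ofNat]
      _ ≤ _ := by
        refine Real.rpow_le_rpow_of_exponent_le one_le_two ?_
        have h := (mul_lt_mul_of_pos_left hN hN0').le
        refine le_trans (le_of_eq ?_) h
        field_simp

end Block

/-! ### From one block to all large powers and to the exponent. -/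

section DomeRank

theorem rankLE_domeOn_of_block {q k l c : ℕ}
    (hc : ((2 * q + 1) ^ 3 + 1) ^ (k + l) * (3 * (k + l) + 1) ^ 4 ≤ c * (k + l).choose k) (s : ℕ)
    {α β : Type} [Fintype α] [DecidableEq α] [Fintype β] [DecidableEq β]
    (hα : Fintype.card α ≤ ((2 * q + 1) ^ k) ^ s) (hβ : Fintype.card β ≤ ((2 * q ^ 3) ^ l) ^ s) :
    RankLE (domeOn α β) (c ^ s * (k + l).choose k) := by
  have hcard : Fintype.card {S : Finset (Fin (k + l)) // S.card = k} = (k + l).choose k := by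
    rw [Fintype.card_finset_len, Fintype.card_fin]
  have : Nonempty {S : Finset (Fin (k + l)) // S.card = k} :=
    Fintype.card_pos_iff.1 (hcard ▸ Nat.choose_pos (Nat.le_add_right _ _))
  obtain ⟨f⟩ : Nonempty (α ↪ (Fin s → Fin k → Option (Fin q × Bool))) := by
    refine Function.Embedding.nonempty_of_card_le (hα.trans (le_of_eq ?_))
    simp [mul_comm]
  obtain ⟨g⟩ : Nonempty (β ↪ (Fin s → Fin l → Fin q × Fin q × Fin q × Bool)) := by
    refine Function.Embedding.nonempty_of_card_le (hβ.trans (le_of_eq ?_))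
    simp
    ring
  rw [← hcard] at hc ⊢
  have h := ((rankLE_kroneckerPow_domeSum q (k + l)).mono hc).restrict restricts_copies_domeOn
  exact (h.kroneckerPow_of_copies s).restrict
    ((restricts_domeOn f g).trans (restricts_domeOn_kroneckerPow s))

/-- The asymptotic rank bound for dome tensors whose weights are at most `(n + 1) ^ (p * N)` and
`M ^ ((1 - p) * N)`, rounded up, for `n = 2 * q` and `M = 2 * q ^ 3`. -/
theorem eventually_rankLE_domeOn {q : ℕ} (hq : 0 < q) {p : ℝ} (hp0 : 0 < p) (hp1 : p < 1) {ε : ℝ}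
    (hε : 0 < ε) :
    ∀ᶠ N : ℕ in atTop, ∀ (α β : Type) [Fintype α] [DecidableEq α] [Fintype β] [DecidableEq β],
      Fintype.card α ≤ ⌈((2 * q + 1 : ℕ) : ℝ) ^ (p * (N : ℝ))⌉₊ →
      Fintype.card β ≤ ⌈((2 * q ^ 3 : ℕ) : ℝ) ^ ((1 - p) * (N : ℝ))⌉₊ →
      ∃ r : ℕ, RankLE (domeOn α β) r ∧ (r : ℝ) ≤ (2 : ℝ) ^ ((N : ℝ) *
        (Real.logb 2 (((2 * q + 1) ^ 3 + 1 : ℕ) : ℝ) - binaryEntropy p + ε)) := by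
  have hR : 2 ≤ (2 * q + 1) ^ 3 + 1 := Nat.succ_le_succ (Nat.one_le_pow _ _ (Nat.succ_pos _))
  obtain ⟨N₀, k, l, c, hN₀, hk, hl, hc, hc'⟩ := exists_block hR hp0 hp1 (half_pos hε)
  set Λ := Real.logb 2 (((2 * q + 1) ^ 3 + 1 : ℕ) : ℝ) - binaryEntropy p with hΛ
  have hL1 : 1 ≤ Real.logb 2 (((2 * q + 1) ^ 3 + 1 : ℕ) : ℝ) := by
    refine (Real.le_logb_iff_rpow_le one_lt_two (by positivity)).2 ?_
    rw [Real.rpow_one]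
    exact_mod_cast hR
  have hΛ0 : 0 ≤ Λ := sub_nonneg.2 ((binaryEntropy_le_one p).trans hL1)
  have hgrow : Tendsto (fun N : ℕ => ((2 : ℝ) ^ (ε / 2)) ^ N) atTop atTop :=
    tendsto_pow_atTop_atTop_of_one_lt (Real.one_lt_rpow one_lt_two (half_pos hε))
  have hpos : (0 : ℝ) < N₀ := Nat.cast_pos.2 hN₀
  filter_upwards [hgrow.eventually_ge_atTop ((2 : ℝ) ^ (N₀ * (Λ + ε / 2)) * (k + l).choose k)]
    with N hN α β _ _ _ _ hα hβ
  -- The block is fixed and repeated just often enough to cover `N`. The overshoot of at most `N₀`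
  -- and the number of copies cost a constant factor, absorbed by `2 ^ (N * ε / 2)`.
  set s := N / N₀ + 1 with hs
  have hsN : (N : ℝ) ≤ N₀ * s := by
    have := (Nat.lt_mul_div_succ N hN₀).le
    exact_mod_cast this
  have hsN' : (N₀ : ℝ) * s ≤ N + N₀ := by
    have : N₀ * s ≤ N + N₀ := by
      rw [hs, mul_add, mul_one]
      exact Nat.add_le_add_right (Nat.mul_div_le N N₀) N₀
    exact_mod_cast this
  have hceil {A m : ℕ} {x : ℝ} (hA : 1 ≤ A) (hx : x * N₀ ≤ m) (hx0 : 0 ≤ x) :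
      ⌈(A : ℝ) ^ (x * (N : ℝ))⌉₊ ≤ (A ^ m) ^ s := by
    -- The right side is an integer, so rounding up the weight costs nothing.
    refine Nat.ceil_le.2 ?_
    rw [← pow_mul, Nat.cast_pow, ← Real.rpow_natCast]
    refine Real.rpow_le_rpow_of_exponent_le (by exact_mod_cast hA) ?_
    calc x * N ≤ x * (N₀ * s) := mul_le_mul_of_nonneg_left hsN hx0
      _ = x * N₀ * s := by ring
      _ ≤ m * s := mul_le_mul_of_nonneg_right hx (Nat.cast_nonneg _)
      _ = _ := by push_cast; ring
  refine ⟨_, rankLE_domeOn_of_block hc s (hα.trans (hceil (by omega) hk hp0.le))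
    (hβ.trans (hceil (Nat.mul_pos two_pos (pow_pos hq 3)) hl (sub_pos.2 hp1).le)), ?_⟩
  calc ((c ^ s * (k + l).choose k : ℕ) : ℝ) = (c : ℝ) ^ s * (k + l).choose k := by push_cast; ring
    _ ≤ (2 ^ (N₀ * (Λ + ε / 2))) ^ s * (k + l).choose k := by gcongr
    _ = 2 ^ (N₀ * s * (Λ + ε / 2)) * (k + l).choose k := by
      rw [← Real.rpow_natCast, ← Real.rpow_mul two_pos.le]
      ring_nf
    _ ≤ 2 ^ ((N + N₀) * (Λ + ε / 2)) * (k + l).choose k := by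
      gcongr
      exact one_le_two
    _ = 2 ^ (N * (Λ + ε / 2)) * (2 ^ (N₀ * (Λ + ε / 2)) * (k + l).choose k) := by
      rw [add_mul, Real.rpow_add two_pos]
      ring
    _ ≤ 2 ^ (N * (Λ + ε / 2)) * (2 ^ (ε / 2)) ^ N := by gcongr
    _ = _ := by
      rw [← Real.rpow_natCast, ← Real.rpow_mul two_pos.le, ← Real.rpow_add two_pos]
      ring_nf

/-- A bound on the exponent from asymptotic bounds on the ranks of the Kronecker powers. -/
theorem tensorExponent_le {V : Type} [Fintype V] {ι : V → Type} {T : CTensor ι} {c : ℝ}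
    (hc : 0 ≤ c)
    (h : ∀ δ : ℝ, 0 < δ → ∀ᶠ s : ℕ in atTop,
      (tensorRank (kroneckerPow T s) : ℝ) ≤ 2 ^ ((s : ℝ) * (c + δ))) :
    tensorExponent T ≤ c := by
  have h0 (s : ℕ) : 0 ≤ (tensorRank (kroneckerPow T s) : ℝ) ^ ((s : ℝ)⁻¹) := by positivity
  have hcob : IsCoboundedUnder (· ≤ ·) atTop
      fun s : ℕ => (tensorRank (kroneckerPow T s) : ℝ) ^ ((s : ℝ)⁻¹) :=
    isCoboundedUnder_le_of_le atTop h0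
  have hroot (δ : ℝ) (hδ : 0 < δ) : ∀ᶠ s : ℕ in atTop,
      (tensorRank (kroneckerPow T s) : ℝ) ^ ((s : ℝ)⁻¹) ≤ 2 ^ (c + δ) := by
    filter_upwards [h δ hδ, eventually_gt_atTop 0] with s hs hs0
    have hs0' : (s : ℝ) ≠ 0 := by positivity
    calc _ ≤ ((2 : ℝ) ^ ((s : ℝ) * (c + δ))) ^ ((s : ℝ)⁻¹) :=
          Real.rpow_le_rpow (Nat.cast_nonneg _) hs (by positivity)
      _ = _ := by
        rw [← Real.rpow_mul two_pos.le]
        congr 1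
        field_simp
  have hnonneg : 0 ≤ asymptoticRank T :=
    le_limsup_of_frequently_le (Frequently.of_forall h0)
      (isBoundedUnder_of_eventually_le (hroot 1 one_pos))
  refine le_of_forall_pos_le_add fun δ hδ => ?_
  rcases hnonneg.eq_or_lt with h' | h'
  -- For asymptotic rank zero the logarithm takes the default value `0`, hence the need for `0 ≤ c`.
  · rw [tensorExponent, ← h', Real.logb_zero]
    positivity
  · exact (Real.logb_le_iff_le_rpow one_lt_two h').2 (limsup_le_of_le hcob (hroot δ hδ))

theorem rankLE_domeOn_of_subsingleton (α β : Type) [DecidableEq α] [DecidableEq β]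
    [Subsingleton α] [Subsingleton β] : RankLE (domeOn α β) 1 := by
  refine RankLE.of_fintype (J := Unit) (fun _ _ _ => 1) (fun x => ?_) (by simp)
  rw [domeOn, if_pos ⟨fun _ => Subsingleton.elim _ _, Subsingleton.elim _ _,
    Subsingleton.elim _ _⟩]
  simp

end DomeRank

/-- The weights `(n+1)^p` and `M^(1-p)` need not be integers. The first part is the bound
`ω(Dome((n+1)^p; M^(1-p))) ≤ log ((n+1)^3+1) - h(p)` read on every Kronecker power for which the
weights are integers. The second part is the asymptotic bound for every `p`, also if no power has
integer weights, with the weights of the `N`-th power rounded up. -/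
theorem theorem4p3 (n M : ℕ) (hn : 2 ≤ n) (hne : Even n) (hM : 4 * M = n ^ 3)
    (p : ℝ) (hp0 : 0 < p) (hp1 : p < 1) :
    (∀ N a b : ℕ, (a : ℝ) = ((n : ℝ) + 1) ^ (p * (N : ℝ)) →
        (b : ℝ) = (M : ℝ) ^ ((1 - p) * (N : ℝ)) →
        tensorExponent (domeTensor a a a b) ≤
          (N : ℝ) * (Real.logb 2 (((n : ℝ) + 1) ^ 3 + 1) - binaryEntropy p)) ∧
    (∀ ε : ℝ, 0 < ε → ∀ᶠ N : ℕ in Filter.atTop,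
        (tensorRank (domeTensor ⌈((n : ℝ) + 1) ^ (p * (N : ℝ))⌉₊ ⌈((n : ℝ) + 1) ^ (p * (N : ℝ))⌉₊
            ⌈((n : ℝ) + 1) ^ (p * (N : ℝ))⌉₊ ⌈(M : ℝ) ^ ((1 - p) * (N : ℝ))⌉₊) : ℝ) ≤
          (2 : ℝ) ^ ((N : ℝ) *
            (Real.logb 2 (((n : ℝ) + 1) ^ 3 + 1) - binaryEntropy p + ε))) := by
  obtain ⟨q, rfl⟩ : ∃ q, n = 2 * q := hne.exists_two_nsmul _ |>.imp fun q h => by simpa using h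
  obtain rfl : M = 2 * q ^ 3 := by
    have : (2 * q) ^ 3 = 8 * q ^ 3 := by ring
    omega
  have hq : 0 < q := by omega
  have hcast : ((2 * q : ℕ) : ℝ) + 1 = ((2 * q + 1 : ℕ) : ℝ) := by push_cast; ring
  have hcast' : ((2 * q + 1 : ℕ) : ℝ) ^ 3 + 1 = (((2 * q + 1) ^ 3 + 1 : ℕ) : ℝ) := by push_cast; ring
  have hApos : (0 : ℝ) < ((2 * q + 1 : ℕ) : ℝ) := by positivity
  have hBpos : (0 : ℝ) < ((2 * q ^ 3 : ℕ) : ℝ) := by positivity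
  rw [hcast, hcast']
  set Λ := Real.logb 2 (((2 * q + 1) ^ 3 + 1 : ℕ) : ℝ) - binaryEntropy p with hΛ
  have hΛ0 : 0 ≤ Λ := by
    refine sub_nonneg.2 ((binaryEntropy_le_one p).trans ?_)
    refine (Real.le_logb_iff_rpow_le one_lt_two (by positivity)).2 ?_
    rw [Real.rpow_one]
    exact_mod_cast Nat.succ_le_succ (Nat.one_le_pow 3 (2 * q + 1) (Nat.succ_pos _))
  refine ⟨fun N a b ha hb => ?_, fun ε hε => ?_⟩
  · have : NeZero a := ⟨fun h => (Real.rpow_pos_of_pos hApos (p * N)).ne (by rw [← ha, h, Nat.cast_zero])⟩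
    have : NeZero b := ⟨fun h => (Real.rpow_pos_of_pos hBpos ((1 - p) * N)).ne (by rw [← hb, h, Nat.cast_zero])⟩
    have hrestr (s : ℕ) : Restricts (kroneckerPow (domeTensor a a a b) s)
        (domeOn (Fin s → Fin a) (Fin s → Fin b)) :=
      ((domeTensor_restricts a b).kroneckerPow s).trans (kroneckerPow_domeOn_restricts s)
    refine tensorExponent_le (mul_nonneg (Nat.cast_nonneg _) hΛ0) fun δ hδ => ?_
    -- For `N = 0` both weights are 1, and `N * s` does not tend to infinity.
    rcases Nat.eq_zero_or_pos N with rfl | hN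
    · obtain rfl : a = 1 := by simpa using ha
      obtain rfl : b = 1 := by simpa using hb
      refine Eventually.of_forall fun s => ?_
      have h := ((rankLE_domeOn_of_subsingleton _ _).restrict (hrestr s)).tensorRank_le
      calc _ ≤ (1 : ℝ) := by exact_mod_cast h
        _ ≤ _ := Real.one_le_rpow one_le_two (by simp; positivity)
    · have hN' : (0 : ℝ) < N := Nat.cast_pos.2 hN
      have hmul : Tendsto (fun s : ℕ => N * s) atTop atTop :=
        tendsto_id.const_mul_atTop' hN
      -- The `s`-th power has weights `a ^ s` and `b ^ s`, those belonging to `N * s`; the slack `δ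
      -- / N` there becomes `δ` per factor.
      filter_upwards [hmul.eventually (eventually_rankLE_domeOn hq hp0 hp1 (div_pos hδ hN'))]
        with s hs
      have hpow {A m : ℕ} {x : ℝ} (hA : 0 ≤ (A : ℝ)) (hm : (m : ℝ) = (A : ℝ) ^ (x * (N : ℝ))) :
          Fintype.card (Fin s → Fin m) ≤ ⌈(A : ℝ) ^ (x * ((N * s : ℕ) : ℝ))⌉₊ := by
        have : (A : ℝ) ^ (x * ((N * s : ℕ) : ℝ)) = ((m ^ s : ℕ) : ℝ) := by
          rw [Nat.cast_mul, ← mul_assoc, Real.rpow_mul hA, ← hm, Real.rpow_natCast, Nat.cast_pow]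
        rw [this, Nat.ceil_natCast]
        simp
      obtain ⟨r, hr, hr'⟩ := hs _ _ (hpow hApos.le ha) (hpow hBpos.le hb)
      have h := (hr.restrict (hrestr s)).tensorRank_le
      calc _ ≤ (r : ℝ) := by exact_mod_cast h
        _ ≤ _ := hr'
        _ = _ := by
          rw [← hΛ, Nat.cast_mul]
          congr 1
          field_simp
  · filter_upwards [eventually_rankLE_domeOn hq hp0 hp1 hε] with N hN
    have : NeZero ⌈((2 * q + 1 : ℕ) : ℝ) ^ (p * (N : ℝ))⌉₊ :=
      ⟨(Nat.ceil_pos.2 (Real.rpow_pos_of_pos hApos _)).ne'⟩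
    have : NeZero ⌈((2 * q ^ 3 : ℕ) : ℝ) ^ ((1 - p) * (N : ℝ))⌉₊ :=
      ⟨(Nat.ceil_pos.2 (Real.rpow_pos_of_pos hBpos _)).ne'⟩
    obtain ⟨r, hr, hr'⟩ := hN (Fin _) (Fin _) (by rw [Fintype.card_fin]) (by rw [Fintype.card_fin])
    have h := (hr.restrict (domeTensor_restricts _ _)).tensorRank_le
    calc _ ≤ (r : ℝ) := by exact_mod_cast h
      _ ≤ _ := hr'
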